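/- Let $q=5^r$ with $r\ge 1$ an integer, and let $\mathbb{F}_q$ be the finite field with $q$ elements. For a monic polynomial $f\in\mathbb{F}_q[T]$, let $\Lambda_q(f)=\deg P$ if $f=P^k$ for some monic irreducible polynomial $P\in\mathbb{F}_q[T]$ and some integer $k\ge 1$, and $\Lambda_q(f)=0$ otherwise. For $n\ge 3$ and $t_1,t_2,t_3\in\mathbb{F}_q$ let $$\psi_q(n,t_1,t_2,t_3)=\sum_{f}\Lambda_q(f),$$ where $f$ runs over all monic polynomials of degree $n$ in $\mathbb{F}_q[T]$ whose coefficients of $T^{n-1},T^{n-2},T^{n-3}$ are $t_1,t_2,t_3$, respectively. Then for all $t_1,t_2,t_3\in\mathbb{F}_q$, $$\psi_q(60,t_1,t_2,t_3)=q^{57}-q^{28}\left(2q^{2}\cdot 1_{t_1=t_2=t_3=0}-q\cdot 1_{t_1=t_2=0}-1_{t_1=0}\right),$$ where $1_{E}$ equals $1$ if the condition $E$ holds and $0$ otherwise. -/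

import Mathlib

open Polynomial

noncomputable section

namespace PrescribedCoeff

variable {F : Type*} [Field F]

/-- The set of monic polynomials of degree `n` over `F`. -/
def monicOfDegree (F : Type*) [Field F] (n : ℕ) : Set F[X] :=
  {f | f.Monic ∧ f.natDegree = n}

/-- Over a finite field there are only finitely many monic polynomials of degree `n`. -/
theorem finite_monicOfDegree (F : Type*) [Field F] [Finite F] (n : ℕ) :
    (monicOfDegree F n).Finite := by
  refine Set.Finite.of_injOn (f := fun f : F[X] => fun i : Fin (n + 1) => f.coeff i)
    (t := Set.univ) (fun _ _ => Set.mem_univ _) ?_ Set.finite_univ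
  intro f hf g hg hfg
  ext i
  by_cases hi : i < n + 1
  · exact congrFun hfg ⟨i, hi⟩
  · have h1 : f.natDegree < i := by rw [hf.2]; omega
    have h2 : g.natDegree < i := by rw [hg.2]; omega
    rw [coeff_eq_zero_of_natDegree_lt h1, coeff_eq_zero_of_natDegree_lt h2]

/-- The `j`-th next-to-leading coefficient of `f`, that is the coefficient of `T ^ (deg f - j)`,
considered to be `0` when `j > deg f`. -/
def nextToLeadingCoeff (f : F[X]) (j : ℕ) : F :=
  if j ≤ f.natDegree then f.coeff (f.natDegree - j) else 0

open Classical in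
/-- The von Mangoldt function on monic polynomials: `deg P` if `f = P ^ k` with `P` monic
irreducible and `k ≥ 1`, and `0` otherwise. The choice of `P` does not matter, see
`vonMangoldt_pow`. -/
def vonMangoldt (f : F[X]) : ℂ :=
  if h : ∃ P : F[X], (P.Monic ∧ Irreducible P) ∧ ∃ k : ℕ, 1 ≤ k ∧ f = P ^ k then
    (h.choose.natDegree : ℂ)
  else 0

theorem vonMangoldt_pow {P : F[X]} (hP : P.Monic) (hirr : Irreducible P) {k : ℕ} (hk : 1 ≤ k) :
    vonMangoldt (P ^ k) = (P.natDegree : ℂ) := by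
  have h : ∃ Q : F[X], (Q.Monic ∧ Irreducible Q) ∧ ∃ m : ℕ, 1 ≤ m ∧ P ^ k = Q ^ m :=
    ⟨P, ⟨hP, hirr⟩, k, hk, rfl⟩
  rw [vonMangoldt, dif_pos h]
  obtain ⟨⟨hQm, hQi⟩, m, hm, hPQ⟩ := h.choose_spec
  have hdvd : P ∣ h.choose ^ m := hPQ ▸ dvd_pow_self P (by omega)
  have hd : P ∣ h.choose := hirr.prime.dvd_of_dvd_pow hdvd
  have hass : Associated P h.choose := hirr.associated_of_dvd hQi hd
  rw [← eq_of_monic_of_associated hP hQm hass]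

theorem vonMangoldt_eq_zero {f : F[X]}
    (h : ¬ ∃ P : F[X], (P.Monic ∧ Irreducible P) ∧ ∃ k : ℕ, 1 ≤ k ∧ f = P ^ k) :
    vonMangoldt f = 0 := by
  rw [vonMangoldt, dif_neg h]

open Classical in
/-- `psi n t` is the sum of the von Mangoldt function over the monic polynomials of degree `n`
over the finite field `F` whose first `ℓ` next-to-leading coefficients are
`t 0, …, t (ℓ - 1)`. -/
def psi [Finite F] (n : ℕ) {ℓ : ℕ} (t : Fin ℓ → F) : ℂ :=
  ∑ f ∈ (finite_monicOfDegree F n).toFinset with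
    (∀ i : Fin ℓ, nextToLeadingCoeff f (i + 1) = t i), vonMangoldt f

end PrescribedCoeff

end

noncomputable section

namespace PrescribedCoeff

/-! Let `K` be the extension of `F` of degree 60. Each `x` in `K` has a characteristic polynomial
over `F`, a power of its minimal polynomial, and a monic `f` of degree 60 arises from exactly
`vonMangoldt f` elements. Hence `psi` counts elements of `K` (`psi_eq_card`). By Newton's
identities, invertible in characteristic 5 because 2 and 3 are units, the three coefficients can be
exchanged for the traces of `x`, `x ^ 2`, `x ^ 3` (`psi_three_eq_card_trace`). Orthogonality of
characters then reduces the count to the sums of `ψ (Tr (a x + b x ^ 2 + c x ^ 3))` over `K`. Since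
5 divides 60, constants of `F` have trace 0, so completing the square or the cube costs nothing. It
remains to see that the sum is `-q ^ 30` when `c = 0`, `b ≠ 0`, and `-2 q ^ 30` when `c ≠ 0`.

Let `L` be the subfield of degree 30 and `Q = q ^ 30`. The quadratic sum is `-G ^ 2` for a Gauss sum
`G` over `L` with `G ^ 2 = Q`. For the cubic sum `S`, restricting `x` to squares and to nonsquares
times squares gives `2 S = A + B`, with `A` and `B` sums of `ψ (c y ^ 6 + a y ^ 2)` and its twist.
As `y ^ 5` is additive, these are sums of quadratic forms over 𝔽₅, so `A ^ 2` and `B ^ 2` are `Q`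
times the sizes of their radicals (`sextic_sum_sq`). The geometric radical is a symplectic plane
over 𝔽₅ on which Frobenius acts through SL₂(𝔽₅). As PSL₂(𝔽₅) has exponent 30, the Frobenius of `L`
acts by a sign, and the two radicals have 25 and 1 elements in some order. So `S ^ 2` is `9 Q` or `4
Q` (`cubic_sum_sq`).

The relation `S_K = 2 Q - S_L ^ 2` (`sum_traceLift_cubic`) leaves `S_K = -7 Q` or `-2 Q`. The same
dichotomy over `K` rules out the first (`sum_traceLift_cubic_eq`). -/

/-! ### Exponential sums of quadratic forms in characteristic 5. -/

theorem sum_comp_sq_add_sum_comp_mul_sq {L : Type*} [Field L] [Fintype L] [CharP L 5]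
    {g : L} (hg : ¬ IsSquare g) (f : L → ℂ) :
    ∑ y, f (y ^ 2) + ∑ y, f (g * y ^ 2) = 2 * ∑ x, f x := by
  classical
  have h2 : ringChar L ≠ 2 := by rw [ringChar.eq L 5]; norm_num
  have hg0 : g ≠ 0 := by rintro rfl; exact hg ⟨0, by simp⟩
  -- An element `x` has `1 + χ x` square roots, `χ` the quadratic character; replacing `x` by `g *
  -- x` flips the sign of `χ`, so the two weights add up to 2.
  have key (f : L → ℂ) : ∑ y, f (y ^ 2) = ∑ x, ((quadraticChar L x : ℤ) + 1 : ℂ) * f x := by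
    rw [← Finset.sum_fiberwise_of_maps_to (s := Finset.univ) (t := Finset.univ)
      (g := fun y : L => y ^ 2) (fun _ _ => Finset.mem_univ _)]
    refine Finset.sum_congr rfl fun x _ => ?_
    rw [Finset.sum_congr rfl (g := fun _ => f x)
      (fun y hy => by rw [(Finset.mem_filter.1 hy).2]), Finset.sum_const, nsmul_eq_mul]
    congr 1
    have := quadraticChar_card_sqrts h2 x
    rw [show (({y | y ^ 2 = x} : Set L).toFinset) = Finset.univ.filter (fun y => y ^ 2 = x) by
      ext; simp] at this
    exact_mod_cast this
  rw [key f, key fun x => f (g * x),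
    ← Equiv.sum_comp (Equiv.mulLeft₀ g hg0) fun x => ((quadraticChar L x : ℤ) + 1 : ℂ) * f x,
    ← Equiv.sum_comp (Equiv.mulLeft₀ g hg0) f, ← Finset.sum_add_distrib, Finset.mul_sum]
  refine Finset.sum_congr rfl fun x _ => ?_
  have : quadraticChar L g = -1 := quadraticChar_neg_one_iff_not_isSquare.2 hg
  simp only [Equiv.mulLeft₀_apply, map_mul, this]
  push_cast
  ring

/-- The additive polynomial whose zeros form the radical of the quadratic form
`Tr (c y ^ 6 + a y ^ 2)` in characteristic `5`. -/
def radicalEval {R : Type*} [CommRing R] (c a y : R) : R := c ^ 5 * y ^ 25 + 2 * a ^ 5 * y ^ 5 + c * y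

theorem five_eq_zero (L : Type*) [Field L] [CharP L 5] : (5 : L) = 0 := by
  exact_mod_cast CharP.cast_eq_zero L 5

theorem add_pow_five {L : Type*} [Field L] [CharP L 5] (x y : L) :
    (x + y) ^ 5 = x ^ 5 + y ^ 5 := by
  have : Fact (Nat.Prime 5) := ⟨by norm_num⟩
  exact add_pow_char x y 5

/-- The left side is the polar form of `c y ^ 6 + a y ^ 2`. Invariance of `ψ` under Frobenius allows
all terms in `z` to be raised to `z ^ 5`, which exposes the radical as the zeros of one polynomial
in `h`. -/
theorem addChar_sextic_polarization {L : Type*} [Field L] [CharP L 5]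
    {ψ : AddChar L ℂ} (h5 : ∀ x, ψ (x ^ 5) = ψ x) (c a h z : L) :
    ψ (c * (z ^ 5 * h + z * h ^ 5) + 2 * a * z * h) = ψ (z ^ 5 * radicalEval c a h) := by
  have h0 := five_eq_zero L
  have e : z ^ 5 * radicalEval c a h
      = c * h * z ^ 5 + (z * (c * h ^ 5 + 2 * a * h)) ^ 5 := by
    rw [mul_pow, add_pow_five, radicalEval]
    linear_combination (-6 * z ^ 5 * a ^ 5 * h ^ 5) * h0
  rw [e, AddChar.map_add_eq_mul ψ (c * h * z ^ 5), h5, ← AddChar.map_add_eq_mul]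
  congr 1
  ring

-- The usual evaluation of a quadratic Gauss sum: write the square as a double sum, substitute `y =
-- z + h`, and sum over `z`; only `h` in the radical survives.
open Classical in
theorem sextic_sum_sq {L : Type*} [Field L] [Fintype L] [CharP L 5]
    {ψ : AddChar L ℂ} (hψ : ψ.IsPrimitive) (h5 : ∀ x, ψ (x ^ 5) = ψ x) (c a : L) :
    (∑ y, ψ (c * y ^ 6 + a * y ^ 2)) ^ 2 =
      Fintype.card L * (Finset.univ.filter fun h : L => radicalEval c a h = 0).card := by
  have h0 := five_eq_zero L
  have : Fact (Nat.Prime 5) := ⟨by norm_num⟩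
  have h2 : (2 : L) ≠ 0 := fun h => one_ne_zero (α := L) (by linear_combination h0 - 2 * h)
  -- Scaling by 2 negates the form, because `2 ^ 6` and `2 ^ 2` are both `-1` modulo 5.
  have hneg : ∑ z, ψ (c * z ^ 6 + a * z ^ 2) = ∑ z, ψ (-(c * z ^ 6 + a * z ^ 2)) := by
    rw [← Equiv.sum_comp (Equiv.mulLeft₀ 2 h2)]
    refine Finset.sum_congr rfl fun z _ => ?_
    simp only [Equiv.mulLeft₀_apply]
    congr 1
    linear_combination (13 * c * z ^ 6 + a * z ^ 2) * h0
  -- Polarizing at `z = h` shows that `ψ` is 1 at twice the form, and `3 * 2 = 1` modulo 5.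
  have hrad (h : L) (hh : radicalEval c a h = 0) : ψ (c * h ^ 6 + a * h ^ 2) = 1 := by
    have := addChar_sextic_polarization h5 c a h h
    rw [hh, mul_zero, AddChar.map_zero_eq_one,
      show c * (h ^ 5 * h + h * h ^ 5) + 2 * a * h * h = 2 • (c * h ^ 6 + a * h ^ 2) by
        rw [two_nsmul]; ring] at this
    rw [show c * h ^ 6 + a * h ^ 2 = 3 • (2 • (c * h ^ 6 + a * h ^ 2)) by
      simp only [nsmul_eq_mul]; push_cast
      linear_combination (-(c * h ^ 6 + a * h ^ 2)) * h0, AddChar.map_nsmul_eq_pow, this, one_pow]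
  have hstep (h z : L) : ψ (c * (z + h) ^ 6 + a * (z + h) ^ 2) * ψ (-(c * z ^ 6 + a * z ^ 2)) =
      ψ (c * h ^ 6 + a * h ^ 2) * ψ (z ^ 5 * radicalEval c a h) := by
    rw [← addChar_sextic_polarization h5, ← AddChar.map_add_eq_mul, ← AddChar.map_add_eq_mul]
    congr 1
    rw [pow_succ (z + h) 5, add_pow_five]
    ring
  calc (∑ y, ψ (c * y ^ 6 + a * y ^ 2)) ^ 2
      = ∑ z, ∑ y, ψ (c * y ^ 6 + a * y ^ 2) * ψ (-(c * z ^ 6 + a * z ^ 2)) := by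
        rw [sq]; nth_rw 2 [hneg]
        rw [Finset.sum_mul_sum, Finset.sum_comm]
    _ = ∑ z, ∑ h, ψ (c * h ^ 6 + a * h ^ 2) * ψ (z ^ 5 * radicalEval c a h) := by
        refine Finset.sum_congr rfl fun z _ => ?_
        rw [← Equiv.sum_comp (Equiv.addLeft z)]
        exact Finset.sum_congr rfl fun h _ => hstep h z
    _ = ∑ h, ψ (c * h ^ 6 + a * h ^ 2) * ∑ w, ψ (w * radicalEval c a h) := by
        rw [Finset.sum_comm]
        refine Finset.sum_congr rfl fun h _ => ?_
        rw [← Finset.mul_sum]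
        congr 1
        exact Equiv.sum_comp (frobeniusEquiv L 5).toEquiv fun w => ψ (w * radicalEval c a h)
    _ = ∑ h, if radicalEval c a h = 0 then (Fintype.card L : ℂ) else 0 := by
        refine Finset.sum_congr rfl fun h _ => ?_
        rw [AddChar.sum_mulShift _ hψ]
        split_ifs with hh
        · rw [hrad h hh, one_mul]
        · simp
    _ = _ := by
        rw [← Finset.sum_filter, Finset.sum_const, nsmul_eq_mul, mul_comm]

theorem gauss_sum_sq {L : Type*} [Field L] [Fintype L] [CharP L 5]
    {ψ : AddChar L ℂ} (hψ : ψ.IsPrimitive) {b : L} (hb : b ≠ 0) :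
    (∑ y, ψ (b * y ^ 2)) ^ 2 = Fintype.card L := by
  classical
  have h0 := five_eq_zero L
  have h2 : (2 : L) ≠ 0 := fun h => one_ne_zero (α := L) (by linear_combination h0 - 2 * h)
  have hneg : ∑ z, ψ (b * z ^ 2) = ∑ z, ψ (-(b * z ^ 2)) := by
    rw [← Equiv.sum_comp (Equiv.mulLeft₀ 2 h2)]
    refine Finset.sum_congr rfl fun z _ => ?_
    simp only [Equiv.mulLeft₀_apply]
    congr 1
    linear_combination (b * z ^ 2) * h0
  calc (∑ y, ψ (b * y ^ 2)) ^ 2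
      = ∑ z, ∑ y, ψ (b * y ^ 2) * ψ (-(b * z ^ 2)) := by
        rw [sq]; nth_rw 2 [hneg]
        rw [Finset.sum_mul_sum, Finset.sum_comm]
    _ = ∑ z, ∑ h, ψ (b * h ^ 2) * ψ (z * (2 * b * h)) := by
        refine Finset.sum_congr rfl fun z _ => ?_
        rw [← Equiv.sum_comp (Equiv.addLeft z)]
        refine Finset.sum_congr rfl fun h _ => ?_
        rw [← AddChar.map_add_eq_mul, ← AddChar.map_add_eq_mul, Equiv.coe_addLeft]
        congr 1
        ring
    _ = ∑ h, ψ (b * h ^ 2) * ∑ w, ψ (w * (2 * b * h)) := by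
        rw [Finset.sum_comm]
        exact Finset.sum_congr rfl fun h _ => (Finset.mul_sum ..).symm
    _ = ∑ h : L, if h = 0 then (Fintype.card L : ℂ) else 0 := by
        refine Finset.sum_congr rfl fun h _ => ?_
        rw [AddChar.sum_mulShift _ hψ]
        by_cases hh : h = 0
        · simp [hh]
        · simp [hh, h2, hb]
    _ = _ := by simp

theorem two_mul_cubic_sum {L : Type*} [Field L] [Fintype L] [CharP L 5]
    (ψ : AddChar L ℂ) {g : L} (hg : ¬ IsSquare g) (c a : L) :
    2 * ∑ x, ψ (c * x ^ 3 + a * x) = ∑ y, ψ (c * y ^ 6 + a * y ^ 2) +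
      ∑ y, ψ (c * g ^ 3 * y ^ 6 + a * g * y ^ 2) := by
  rw [← sum_comp_sq_add_sum_comp_mul_sq hg]
  congr 1 <;> refine Finset.sum_congr rfl fun y _ => ?_ <;> congr 1 <;> ring

/-! ### The radical as a symplectic plane over 𝔽₅ and the action of Frobenius. -/

theorem eq_of_pow_five_eq_self {R : Type*} [Field R] [CharP R 5] {x : R} (hx : x ^ 5 = x) :
    x = 0 ∨ x = 1 ∨ x = -1 ∨ x = 2 ∨ x = -2 := by
  have h0 := five_eq_zero R
  have h : x * ((x - 1) * ((x + 1) * ((x - 2) * (x + 2)))) = 0 := by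
    linear_combination hx + (x - x ^ 3) * h0
  simpa only [mul_eq_zero, sub_eq_zero, add_eq_zero_iff_eq_neg] using h

theorem map_eq_self_of_pow_five_eq_self {R : Type*} [Field R] [CharP R 5] (φ : R →+* R) {x : R}
    (hx : x ^ 5 = x) : φ x = x := by
  rcases eq_of_pow_five_eq_self hx with rfl | rfl | rfl | rfl | rfl <;>
    simp [map_ofNat φ 2]

/-- The alternating form on the zeros of `radicalEval c a`. -/
def radicalForm {R : Type*} [CommRing R] (c v w : R) : R := c * (v * w ^ 5 - v ^ 5 * w)

/-- On the radical the alternating form takes values in 𝔽₅, so every ring endomorphism fixes its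
values. -/
theorem radicalForm_pow_five {R : Type*} [Field R] [CharP R 5] {c a v w : R}
    (hv : radicalEval c a v = 0) (hw : radicalEval c a w = 0) :
    radicalForm c v w ^ 5 = radicalForm c v w := by
  have : Fact (Nat.Prime 5) := ⟨by norm_num⟩
  rw [radicalForm, mul_pow, sub_pow_char]
  rw [radicalEval] at hv hw
  linear_combination v ^ 5 * hw - w ^ 5 * hv

theorem map_radicalEval {R S : Type*} [CommRing R] [CommRing S] (φ : R →+* S) (c a v : R) :
    φ (radicalEval c a v) = radicalEval (φ c) (φ a) (φ v) := by
  simp [radicalEval, map_ofNat φ 2]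

theorem map_radicalForm {R S : Type*} [CommRing R] [CommRing S] (φ : R →+* S) (c v w : R) :
    φ (radicalForm c v w) = radicalForm (φ c) (φ v) (φ w) := by
  simp [radicalForm]

theorem iterate_mul_eq_or_eq_neg {R : Type*} [Ring R] (φ : R →+* R) {v : R} {m : ℕ}
    (h : φ^[m] v = v ∨ φ^[m] v = -v) (j : ℕ) : φ^[m * j] v = v ∨ φ^[m * j] v = -v := by
  induction j with
  | zero => simp
  | succ j ih =>
    rw [Nat.mul_succ, Function.iterate_add_apply]
    rcases h with h | h <;> rcases ih with ih | ih <;>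
      simp [h, ih, iterate_map_neg]

/-- A field endomorphism fixing `c` and `a` acts on the zeros of `radicalEval c a` through
`SL₂(𝔽₅)`, hence its `30`-th power acts by a sign. -/
theorem iterate_eq_or_eq_neg_of_radicalEval_eq_zero {R : Type*} [Field R] [CharP R 5]
    (φ : R →+* R) {c a v : R} (hc0 : c ≠ 0) (hc : φ c = c) (ha : φ a = a)
    (hv : radicalEval c a v = 0) {n : ℕ} (hn : 30 ∣ n) : φ^[n] v = v ∨ φ^[n] v = -v := by
  have h0 := five_eq_zero R
  suffices h : ∃ m, m ∣ 30 ∧ (φ^[m] v = v ∨ φ^[m] v = -v) by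
    obtain ⟨m, hm, h⟩ := h
    obtain ⟨j, rfl⟩ := hm.trans hn
    exact iterate_mul_eq_or_eq_neg φ h j
  by_cases hv0 : v = 0
  · exact ⟨1, by norm_num, by simp [hv0]⟩
  have hφ {w : R} (hw : radicalEval c a w = 0) : radicalEval c a (φ w) = 0 := by
    have := congrArg φ hw
    rwa [map_radicalEval, hc, ha, map_zero] at this
  -- If the form vanishes, `φ v / v` lies in 𝔽₅ and `v` is an eigenvector, so two steps scale `v` by
  -- a square of 𝔽₅ˣ, that is by a sign.
  by_cases hB : radicalForm c v (φ v) = 0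
  · have hl : (φ v / v) ^ 5 = φ v / v := by
      rw [radicalForm, mul_eq_zero, or_iff_right hc0] at hB
      rw [div_pow, div_eq_div_iff (pow_ne_zero 5 hv0) hv0]
      linear_combination hB
    have hφv : φ v = φ v / v * v := by field_simp
    have h2 : φ (φ v) = (φ v / v) ^ 2 * v := by
      nth_rw 1 [hφv]
      rw [map_mul, map_eq_self_of_pow_five_eq_self φ hl]
      linear_combination (φ v / v) * hφv
    refine ⟨2, by norm_num, ?_⟩
    simp only [Function.iterate_succ, Function.iterate_zero, Function.comp_apply, id_eq]
    rw [h2]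
    rcases eq_of_pow_five_eq_self hl with h | h | h | h | h <;> rw [h]
    · rw [h, zero_mul, map_eq_zero] at hφv
      exact absurd hφv hv0
    · left; ring
    · left; ring
    · right; linear_combination v * h0
    · right; linear_combination v * h0
  · have hinv : radicalForm c (φ v) (φ (φ v)) = radicalForm c v (φ v) := by
      have := map_radicalForm φ c v (φ v)
      rwa [map_eq_self_of_pow_five_eq_self φ (radicalForm_pow_five hv (hφ hv)), hc, eq_comm] at this
    -- Here `v` and `φ v` span the plane. Since `φ` preserves the form it has determinant 1, and `t`
    -- is its trace in the Cayley–Hamilton relation `h2`. The traces 0, 1, -1, 2, -2 make the powers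
    -- 2, 3, 3, 5, 5 of `φ` act on `v` by a sign; all these exponents divide 30.
    set t := radicalForm c v (φ (φ v)) / radicalForm c v (φ v) with ht
    have ht5 : t ^ 5 = t := by
      rw [ht, div_pow, radicalForm_pow_five hv (hφ (hφ hv)), radicalForm_pow_five hv (hφ hv)]
    have h2 : φ (φ v) = t * φ v - v := by
      have e : t * radicalForm c v (φ v) = radicalForm c v (φ (φ v)) := by
        rw [ht]; field_simp
      apply mul_left_cancel₀ hB
      rw [radicalForm] at e hinv ⊢
      rw [radicalForm] at e hinv
      linear_combination (-φ v) * e - v * hinv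
    rcases eq_of_pow_five_eq_self ht5 with h | h | h | h | h <;> rw [h] at h2
    · refine ⟨2, by norm_num, Or.inr ?_⟩
      simp only [Function.iterate_succ, Function.iterate_zero, Function.comp_apply, id_eq, h2]
      ring
    · refine ⟨3, by norm_num, Or.inr ?_⟩
      simp only [Function.iterate_succ, Function.iterate_zero, Function.comp_apply, id_eq, h2,
        map_sub, map_mul, map_one]
      ring
    · refine ⟨3, by norm_num, Or.inl ?_⟩
      simp only [Function.iterate_succ, Function.iterate_zero, Function.comp_apply, id_eq, h2,
        map_sub, map_mul, map_neg, map_one]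
      ring
    · refine ⟨5, by norm_num, Or.inl ?_⟩
      simp only [Function.iterate_succ, Function.iterate_zero, Function.comp_apply, id_eq, h2,
        map_sub, map_mul, map_ofNat]
      linear_combination (φ v - v) * h0
    · refine ⟨5, by norm_num, Or.inr ?_⟩
      simp only [Function.iterate_succ, Function.iterate_zero, Function.comp_apply, id_eq, h2,
        map_sub, map_mul, map_neg, map_ofNat]
      linear_combination (φ v + v) * h0

theorem radicalEval_add {R : Type*} [Field R] [CharP R 5] (c a v w : R) :
    radicalEval c a (v + w) = radicalEval c a v + radicalEval c a w := by
  have : (v + w) ^ 25 = v ^ 25 + w ^ 25 := by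
    rw [show 25 = 5 * 5 by norm_num, pow_mul, pow_mul, pow_mul, add_pow_five, add_pow_five]
  simp only [radicalEval, this, add_pow_five]
  ring

/-- The sign by which the endomorphism acts does not depend on the zero. -/
theorem iterate_forall_eq_or_forall_eq_neg {R : Type*} [Field R] [CharP R 5]
    (φ : R →+* R) {c a : R} (hc0 : c ≠ 0) (hc : φ c = c) (ha : φ a = a) {n : ℕ} (hn : 30 ∣ n) :
    (∀ v, radicalEval c a v = 0 → φ^[n] v = v) ∨ (∀ v, radicalEval c a v = 0 → φ^[n] v = -v) := by
  by_contra! h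
  obtain ⟨⟨v, hv, hv'⟩, w, hw, hw'⟩ := h
  have key {u : R} := iterate_eq_or_eq_neg_of_radicalEval_eq_zero φ (v := u) hc0 hc ha (hn := hn)
  have h2 : (2 : R) ≠ 0 := fun h => one_ne_zero (α := R) (by linear_combination five_eq_zero R - 2 * h)
  have hv1 := (key hv).resolve_left hv'
  have hw1 := (key hw).resolve_right hw'
  have hvw := key (u := v + w) (by rw [radicalEval_add, hv, hw, add_zero])
  rw [iterate_map_add, hv1, hw1] at hvw
  rcases hvw with h | h
  · have : v = 0 := (mul_eq_zero.1 (show (2 : R) * v = 0 by linear_combination -h)).resolve_left h2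
    exact hv' (by rw [hv1, this, neg_zero])
  · have : w = 0 := (mul_eq_zero.1 (show (2 : R) * w = 0 by linear_combination h)).resolve_left h2
    exact hw' (by rw [hw1, this, neg_zero])

/-! ### Counting zeros of the radical polynomial over `L`, and the cubic sum up to sign. -/

/-- The polynomial with evaluation `radicalEval c a`. -/
def radicalPoly {R : Type*} [CommRing R] (c a : R) : R[X] :=
  C (c ^ 5) * X ^ 25 + C (2 * a ^ 5) * X ^ 5 + C c * X

theorem eval_radicalPoly {R : Type*} [CommRing R] (c a v : R) :
    (radicalPoly c a).eval v = radicalEval c a v := by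
  simp [radicalPoly, radicalEval]

theorem natDegree_radicalPoly {R : Type*} [Field R] {c : R} (hc : c ≠ 0) (a : R) :
    (radicalPoly c a).natDegree = 25 := by
  have : c ^ 5 ≠ 0 := pow_ne_zero 5 hc
  rw [radicalPoly]
  compute_degree!

/-- In characteristic 5 the derivative is the nonzero constant `c`. -/
theorem separable_radicalPoly {R : Type*} [Field R] [CharP R 5] {c : R} (hc : c ≠ 0) (a : R) :
    (radicalPoly c a).Separable := by
  have h0 : (5 : R[X]) = 0 := by
    rw [← C_ofNat, five_eq_zero, map_zero]
  have : derivative (radicalPoly c a) = C c := by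
    simp only [radicalPoly, derivative_add, derivative_C_mul, derivative_X_pow, derivative_X, mul_one]
    push_cast
    simp only [map_ofNat]
    linear_combination (5 * C (c ^ 5) * X ^ 24 + C (2 * a ^ 5) * X ^ 4) * h0
  rw [Polynomial.Separable, this]
  exact (isCoprime_one_right (x := radicalPoly c a)).of_isCoprime_of_dvd_right
    (isUnit_C.2 (isUnit_iff_ne_zero.2 hc)).dvd

theorem card_roots_radicalPoly {E : Type*} [Field E] [DecidableEq E] [IsAlgClosed E] [CharP E 5] {c : E} (hc : c ≠ 0)
    (a : E) : (radicalPoly c a).roots.toFinset.card = 25 := by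
  rw [Multiset.toFinset_card_of_nodup (nodup_roots (separable_radicalPoly hc a)),
    ← (IsAlgClosed.splits (radicalPoly c a)).natDegree_eq_card_roots, natDegree_radicalPoly hc]

theorem mem_roots_radicalPoly {R : Type*} [Field R] {c : R} (hc : c ≠ 0) (a v : R) :
    v ∈ (radicalPoly c a).roots ↔ radicalEval c a v = 0 := by
  have : radicalPoly c a ≠ 0 := by
    intro h
    have := natDegree_radicalPoly hc a
    simp [h] at this
  rw [mem_roots this, IsRoot.def, eval_radicalPoly]

theorem mem_range_algebraMap_of_pow_card {L E : Type*} [Field L] [Fintype L] [Field E] [Algebra L E]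
    {x : E} (hx : x ^ Fintype.card L = x) : ∃ y : L, algebraMap L E y = x := by
  classical
  have h1 : 1 < Fintype.card L := Fintype.one_lt_card
  have hne : (X ^ Fintype.card L - X : E[X]) ≠ 0 := FiniteField.X_pow_card_sub_X_ne_zero E h1
  have hsub : Finset.univ.image (algebraMap L E) ⊆
      (X ^ Fintype.card L - X : E[X]).roots.toFinset := by
    intro z hz
    obtain ⟨y, -, rfl⟩ := Finset.mem_image.1 hz
    rw [Multiset.mem_toFinset, mem_roots hne]
    simp [← map_pow, FiniteField.pow_card]
  have heq := Finset.eq_of_subset_of_card_le hsub <| by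
    rw [Finset.card_image_of_injective _ (algebraMap L E).injective, Finset.card_univ]
    refine (Multiset.toFinset_card_le _).trans ((card_roots' _).trans ?_)
    rw [FiniteField.X_pow_card_sub_X_natDegree_eq E h1]
  have : x ∈ (X ^ Fintype.card L - X : E[X]).roots.toFinset := by
    rw [Multiset.mem_toFinset, mem_roots hne]
    simp [hx]
  rw [← heq] at this
  obtain ⟨y, -, hy⟩ := Finset.mem_image.1 this
  exact ⟨y, hy⟩

-- Multiplication by the square root `h` of `g` carries zeros of the twisted polynomial in `L` to
-- those zeros of the original one on which the Frobenius of `L` acts as `e`. It is used with `g = h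
-- = e = 1`, and with `g` a nonsquare and `e = -1`.
open Classical in
theorem card_radical_twist {L E : Type*} [Field L] [Fintype L] [Field E] [Algebra L E]
    {c a g : L} (hc : c ≠ 0) {h e : E} (hg : h ^ 2 = algebraMap L E g) (h0 : h ≠ 0)
    (he : e ^ 2 = 1) (hQ : h ^ Fintype.card L = e * h) :
    (Finset.univ.filter fun y : L => radicalEval (c * g ^ 3) (a * g) y = 0).card =
      ((radicalPoly (algebraMap L E c) (algebraMap L E a)).roots.toFinset.filter
        fun v => v ^ Fintype.card L = e * v).card := by
  have hc' : algebraMap L E c ≠ 0 := by simpa using hc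
  have key (y : L) : algebraMap L E (radicalEval (c * g ^ 3) (a * g) y) =
      h ^ 5 * radicalEval (algebraMap L E c) (algebraMap L E a) (h * algebraMap L E y) := by
    rw [map_radicalEval, map_mul, map_mul, map_pow, ← hg, radicalEval, radicalEval]
    ring
  refine Finset.card_bij (fun y _ => h * algebraMap L E y) ?_ ?_ ?_
  · intro y hy
    rw [Finset.mem_filter] at hy ⊢
    rw [Multiset.mem_toFinset, mem_roots_radicalPoly hc']
    have := key y
    rw [hy.2, map_zero, zero_eq_mul] at this
    refine ⟨this.resolve_left (pow_ne_zero 5 h0), ?_⟩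
    rw [mul_pow, hQ, ← map_pow, FiniteField.pow_card]
    ring
  · intro y _ z _ hyz
    exact (algebraMap L E).injective (mul_left_cancel₀ h0 hyz)
  · intro v hv
    rw [Finset.mem_filter, Multiset.mem_toFinset, mem_roots_radicalPoly hc'] at hv
    have he0 : e ≠ 0 := by rintro rfl; simp at he
    obtain ⟨y, hy⟩ := mem_range_algebraMap_of_pow_card (L := L) (x := v / h) (by
      rw [div_pow, hv.2, hQ, mul_div_mul_left _ _ he0])
    have hy' : h * algebraMap L E y = v := by rw [hy]; field_simp
    refine ⟨y, ?_, hy'⟩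
    rw [Finset.mem_filter]
    refine ⟨Finset.mem_univ _, (algebraMap L E).injective ?_⟩
    rw [key, hy', hv.1, mul_zero, map_zero]

theorem sqrt_nonsquare_pow_card {L E : Type*} [Field L] [Fintype L] [CharP L 5] [Field E]
    [Algebra L E] {g : L} (hg : ¬ IsSquare g) {h : E} (hh : h ^ 2 = algebraMap L E g) :
    h ^ Fintype.card L = -1 * h := by
  have h2 : ringChar L ≠ 2 := by rw [ringChar.eq L 5]; norm_num
  have hg0 : g ≠ 0 := by rintro rfl; exact hg ⟨0, by simp⟩
  have hd := (FiniteField.pow_dichotomy h2 hg0).resolve_left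
    (mt (FiniteField.isSquare_iff h2 hg0).2 hg)
  have hodd := FiniteField.odd_card_of_char_ne_two h2
  rw [show Fintype.card L = 2 * (Fintype.card L / 2) + 1 by omega, pow_succ, pow_mul, hh, ← map_pow,
    hd, map_neg, map_one]

open Classical in
/-- When `card L` is the `n`-th power of the order of the field containing `c` and `a`, with
`30 ∣ n`, the zeros of `radicalEval c a` all lie in `L`, or none but `0` does. -/
theorem card_radical_eq {L E : Type*} [Field L] [Fintype L] [Field E] [IsAlgClosed E]
    [CharP E 5] [Algebra L E] {r n : ℕ} (hn : 30 ∣ n) (hL : Fintype.card L = (5 ^ r) ^ n) {c a : L}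
    (hc0 : c ≠ 0) (hc : c ^ 5 ^ r = c) (ha : a ^ 5 ^ r = a) {V : Finset E}
    (hV : V = (radicalPoly (algebraMap L E c) (algebraMap L E a)).roots.toFinset) :
    ((V.filter fun v => v ^ Fintype.card L = 1 * v).card = 25 ∧
      (V.filter fun v => v ^ Fintype.card L = -1 * v).card = 1) ∨
    ((V.filter fun v => v ^ Fintype.card L = 1 * v).card = 1 ∧
      (V.filter fun v => v ^ Fintype.card L = -1 * v).card = 25) := by
  have hp : Fact (Nat.Prime 5) := ⟨by norm_num⟩
  have hc' : algebraMap L E c ≠ 0 := by simpa using hc0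
  have hcard : V.card = 25 := by rw [hV]; exact card_roots_radicalPoly hc' _
  have hmem (v : E) : v ∈ V ↔ radicalEval (algebraMap L E c) (algebraMap L E a) v = 0 := by
    rw [hV, Multiset.mem_toFinset, mem_roots_radicalPoly hc']
  have hzero : (0 : E) ∈ V := by simp [hmem, radicalEval]
  have hiter (v : E) : (iterateFrobenius E 5 r)^[n] v = v ^ Fintype.card L := by
    have : ⇑(iterateFrobenius E 5 r) = fun x => x ^ 5 ^ r := rfl
    rw [hL, this, pow_iterate]
  have h2 : (2 : E) ≠ 0 := fun h => one_ne_zero (α := E) (by linear_combination five_eq_zero E - 2 * h)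
  have hneg (v : E) (hv : v = -v) : v = 0 :=
    (mul_eq_zero.1 (show (2 : E) * v = 0 by linear_combination hv)).resolve_left h2
  have hpos : Fintype.card L ≠ 0 := Fintype.card_ne_zero
  rcases iterate_forall_eq_or_forall_eq_neg (iterateFrobenius E 5 r) hc'
      (by rw [iterateFrobenius_def, ← map_pow, hc])
      (a := algebraMap L E a) (by rw [iterateFrobenius_def, ← map_pow, ha]) hn
    with H | H
  · left
    constructor
    · rw [Finset.filter_true_of_mem, hcard]
      intro v hv
      rw [← hiter, H v ((hmem v).1 hv), one_mul]
    · rw [Finset.card_eq_one]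
      refine ⟨0, ?_⟩
      ext v
      simp only [Finset.mem_filter, Finset.mem_singleton]
      refine ⟨fun ⟨hv, h⟩ => hneg v ?_, ?_⟩
      · rwa [← hiter, H v ((hmem v).1 hv), neg_one_mul] at h
      · rintro rfl
        exact ⟨hzero, by simp [hpos]⟩
  · right
    constructor
    · rw [Finset.card_eq_one]
      refine ⟨0, ?_⟩
      ext v
      simp only [Finset.mem_filter, Finset.mem_singleton]
      refine ⟨fun ⟨hv, h⟩ => hneg v ?_, ?_⟩
      · rw [← hiter, H v ((hmem v).1 hv), one_mul] at h
        exact h.symm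
      · rintro rfl
        exact ⟨hzero, by simp [hpos]⟩
    · rw [Finset.filter_true_of_mem, hcard]
      intro v hv
      rw [← hiter, H v ((hmem v).1 hv), neg_one_mul]

/-- Of `A` and `B`, one has square `25 Q` and the other, say `B`, has square `Q`. So `A = ± 5 B`,
and `2 S = A + B` is `6 B` or `-4 B`. -/
theorem cubic_sum_sq {L : Type*} [Field L] [Fintype L] [CharP L 5]
    {ψ : AddChar L ℂ} (hψ : ψ.IsPrimitive) (h5 : ∀ x, ψ (x ^ 5) = ψ x) {r n : ℕ} (hn : 30 ∣ n)
    (hL : Fintype.card L = (5 ^ r) ^ n) {c a : L} (hc0 : c ≠ 0) (hc : c ^ 5 ^ r = c)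
    (ha : a ^ 5 ^ r = a) :
    (∑ x, ψ (c * x ^ 3 + a * x)) ^ 2 = 9 * Fintype.card L ∨
      (∑ x, ψ (c * x ^ 3 + a * x)) ^ 2 = 4 * Fintype.card L := by
  classical
  obtain ⟨g, hg⟩ := FiniteField.exists_nonsquare (F := L) (by rw [ringChar.eq L 5]; norm_num)
  have hg0 : g ≠ 0 := by rintro rfl; exact hg ⟨0, by simp⟩
  have : CharP (AlgebraicClosure L) 5 :=
    charP_of_injective_algebraMap (algebraMap L (AlgebraicClosure L)).injective 5
  obtain ⟨h, hh⟩ := IsAlgClosed.exists_pow_nat_eq (algebraMap L (AlgebraicClosure L) g) (n := 2)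
    (by norm_num)
  have hh0 : h ≠ 0 := by
    rintro rfl
    rw [zero_pow two_ne_zero, eq_comm, map_eq_zero] at hh
    exact hg0 hh
  have hW := card_radical_twist (E := AlgebraicClosure L) (a := a) (g := 1) (h := 1) (e := 1) hc0
    (by simp) one_ne_zero (by simp) (by simp)
  have hWg := card_radical_twist (E := AlgebraicClosure L) (a := a) (e := -1) hc0 hh hh0 (by simp)
    (sqrt_nonsquare_pow_card hg hh)
  have hA := sextic_sum_sq hψ h5 c a
  have hB := sextic_sum_sq hψ h5 (c * g ^ 3) (a * g)
  have h2S := two_mul_cubic_sum ψ hg c a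
  rw [one_pow, mul_one, mul_one] at hW
  have hV := card_radical_eq (E := AlgebraicClosure L) hn hL hc0 hc ha rfl
  rw [← hW, ← hWg] at hV
  generalize ∑ y, ψ (c * y ^ 6 + a * y ^ 2) = A at *
  generalize ∑ y, ψ (c * g ^ 3 * y ^ 6 + a * g * y ^ 2) = B at *
  generalize ∑ x, ψ (c * x ^ 3 + a * x) = S at *
  rcases hV with ⟨h1, h2⟩ | ⟨h1, h2⟩ <;> rw [h1] at hA <;> rw [h2] at hB <;> push_cast at hA hB
  · rcases mul_eq_zero.1 (show (A - 5 * B) * (A + 5 * B) = 0 by linear_combination hA - 25 * hB)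
      with h | h
    · left
      have : S = 3 * B := by linear_combination (h2S + h) / 2
      rw [this]; linear_combination 9 * hB
    · right
      have : S = -2 * B := by linear_combination (h2S + h) / 2
      rw [this]; linear_combination 4 * hB
  · rcases mul_eq_zero.1 (show (B - 5 * A) * (B + 5 * A) = 0 by linear_combination hB - 25 * hA)
      with h | h
    · left
      have : S = 3 * A := by linear_combination (h2S + h) / 2
      rw [this]; linear_combination 9 * hA
    · right
      have : S = -2 * A := by linear_combination (h2S + h) / 2
      rw [this]; linear_combination 4 * hA

/-! ### Additive characters lifted along the trace. -/

/-- The lift of an additive character along the trace. -/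
def traceLift {F : Type*} (L : Type*) [Field F] [Field L] [Algebra F L] (ψ : AddChar F ℂ) :
    AddChar L ℂ :=
  ψ.compAddMonoidHom (Algebra.trace F L).toAddMonoidHom

theorem traceLift_apply {F L : Type*} [Field F] [Field L] [Algebra F L] (ψ : AddChar F ℂ) (x : L) :
    traceLift L ψ x = ψ (Algebra.trace F L x) := rfl

theorem traceLift_traceLift {F L K : Type*} [Field F] [Field L] [Field K] [Algebra F L]
    [Algebra L K] [Algebra F K] [IsScalarTower F L K] [FiniteDimensional F L]
    [FiniteDimensional L K] (ψ : AddChar F ℂ) : traceLift K (traceLift L ψ) = traceLift K ψ := by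
  ext x
  simp only [traceLift_apply, Algebra.trace_trace]

theorem traceLift_isPrimitive {F L : Type*} [Field F] [Field L] [Finite L] [Algebra F L]
    {ψ : AddChar F ℂ} (hψ : ψ.IsPrimitive) : (traceLift L ψ).IsPrimitive := by
  have : Finite F := Finite.of_injective _ (algebraMap F L).injective
  refine AddChar.IsPrimitive.of_ne_one fun h => hψ one_ne_zero ?_
  ext y
  obtain ⟨x, hx⟩ := Algebra.trace_surjective F L y
  rw [AddChar.mulShift_one, ← hx, ← traceLift_apply, h, AddChar.one_apply, AddChar.one_apply]

theorem traceLift_pow_five {F L : Type*} [Field F] [Field L] [Finite L] [CharP L 5] [Algebra F L]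
    {ψ : AddChar F ℂ} (h5 : ∀ x, ψ (x ^ 5) = ψ x) (x : L) :
    traceLift L ψ (x ^ 5) = traceLift L ψ x := by
  have : Fact (Nat.Prime 5) := ⟨by norm_num⟩
  rw [traceLift_apply, traceLift_apply, ← h5 (Algebra.trace F L x)]
  refine congrArg ψ ((algebraMap F L).injective ?_)
  rw [map_pow (algebraMap F L), FiniteField.algebraMap_trace_eq_sum_pow, FiniteField.algebraMap_trace_eq_sum_pow,
    sum_pow_char]
  exact Finset.sum_congr rfl fun i _ => pow_right_comm x 5 _

/-- Frobenius invariance comes from lifting a character of the prime field, where the fifth power is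
the identity. -/
theorem exists_primitive_addChar (F : Type*) [Field F] [Finite F] [CharP F 5] :
    ∃ ψ : AddChar F ℂ, ψ.IsPrimitive ∧ ∀ x, ψ (x ^ 5) = ψ x := by
  have : Fact (Nat.Prime 5) := ⟨by norm_num⟩
  let _ := ZMod.algebra F 5
  exact ⟨traceLift F ZMod.stdAddChar, traceLift_isPrimitive (ZMod.isPrimitive_stdAddChar 5),
    traceLift_pow_five fun x => by rw [ZMod.pow_card]⟩

/-! ### Exponential sums over a quadratic extension. -/

section QuadraticExtension

variable {L K : Type*} [Field L] [Fintype L] [Field K] [Fintype K] [Algebra L K]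

theorem card_of_finrank_two (h2 : Module.finrank L K = 2) :
    Fintype.card K = Fintype.card L ^ 2 := by
  rw [Module.card_eq_pow_finrank (K := L) (V := K), h2]

theorem bijective_add_mul_sqrt (h2 : Module.finrank L K = 2) {g : L} (hg : ¬ IsSquare g) {θ : K}
    (hθ : θ ^ 2 = algebraMap L K g) :
    Function.Bijective fun p : L × L => algebraMap L K p.1 + algebraMap L K p.2 * θ := by
  rw [Fintype.bijective_iff_injective_and_card]
  refine ⟨?_, by rw [Fintype.card_prod, card_of_finrank_two h2, sq]⟩
  rintro ⟨u, v⟩ ⟨u', v'⟩ h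
  simp only at h
  by_cases hv : v = v'
  · subst hv
    simpa using h
  · have hv' : v - v' ≠ 0 := sub_ne_zero.2 hv
    exfalso
    refine hg ⟨(u' - u) / (v - v'), (algebraMap L K).injective ?_⟩
    have hv'' : algebraMap L K v - algebraMap L K v' ≠ 0 := by
      rw [← map_sub]; exact (_root_.map_ne_zero _).2 hv'
    have : θ = (algebraMap L K u' - algebraMap L K u) / (algebraMap L K v - algebraMap L K v') := by
      rw [eq_div_iff hv'']
      linear_combination h
    rw [map_mul, map_div₀, map_sub, map_sub, ← this, ← hθ, sq]

theorem sum_eq_sum_add_mul_sqrt (h2 : Module.finrank L K = 2) {g : L} (hg : ¬ IsSquare g) {θ : K}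
    (hθ : θ ^ 2 = algebraMap L K g) (f : K → ℂ) :
    ∑ z, f z = ∑ u, ∑ v, f (algebraMap L K u + algebraMap L K v * θ) := by
  rw [← Fintype.sum_prod_type' (f := fun u v => f (algebraMap L K u + algebraMap L K v * θ))]
  exact ((Equiv.ofBijective _ (bijective_add_mul_sqrt h2 hg hθ)).sum_comp f).symm

variable [CharP L 5]

/-- Euler's criterion: with `Q = card L` odd, `(Q ^ 2 - 1) / 2` is a multiple of `Q - 1`, so this
power of a nonzero `g` is 1. -/
theorem exists_sq_eq_algebraMap (h2 : Module.finrank L K = 2) (g : L) :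
    ∃ θ : K, θ ^ 2 = algebraMap L K g := by
  rcases eq_or_ne g 0 with rfl | hg
  · exact ⟨0, by simp⟩
  have : CharP K 5 := charP_of_injective_algebraMap (algebraMap L K).injective 5
  have hK : ringChar K ≠ 2 := by rw [ringChar.eq K 5]; norm_num
  have hL : ringChar L ≠ 2 := by rw [ringChar.eq L 5]; norm_num
  obtain ⟨m, hm⟩ : ∃ m, Fintype.card L = 2 * m + 1 :=
    ⟨Fintype.card L / 2, by have := FiniteField.odd_card_of_char_ne_two hL; omega⟩
  have : IsSquare (algebraMap L K g) := by
    rw [FiniteField.isSquare_iff hK (by simpa using hg), card_of_finrank_two h2, ← map_pow,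
      show Fintype.card L ^ 2 / 2 = (Fintype.card L - 1) * (m + 1) by
        rw [hm, show (2 * m + 1) ^ 2 = 2 * (2 * m * (m + 1)) + 1 by ring, Nat.add_sub_cancel]
        omega,
      pow_mul, FiniteField.pow_card_sub_one_eq_one g hg, one_pow, map_one]
  obtain ⟨θ, hθ⟩ := this
  exact ⟨θ, by rw [hθ, sq]⟩

theorem trace_add_mul_sqrt (h2 : Module.finrank L K = 2) {g : L} (hg : ¬ IsSquare g) {θ : K}
    (hθ : θ ^ 2 = algebraMap L K g) (u v : L) :
    Algebra.trace L K (algebraMap L K u + algebraMap L K v * θ) = 2 * u := by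
  apply (algebraMap L K).injective
  rw [FiniteField.algebraMap_trace_eq_sum_pow, h2, Finset.sum_range_succ, Finset.sum_range_one,
    pow_zero, pow_one, pow_one, Nat.card_eq_fintype_card]
  have := congrFun (FiniteField.coe_frobeniusAlgHom L K) (algebraMap L K u + algebraMap L K v * θ)
  rw [← this, map_add, map_mul, AlgHom.commutes, AlgHom.commutes, FiniteField.coe_frobeniusAlgHom]
  simp only
  rw [sqrt_nonsquare_pow_card hg hθ, map_mul, map_ofNat (algebraMap L K) 2]
  ring

/-- In the coordinates `u + v θ` the sum factors as a Gauss sum times its twist by the nonsquare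
`g`. The two factors are opposite, and the square of each is `card L`. -/
theorem sum_traceLift_quadratic (h2 : Module.finrank L K = 2) {ψ : AddChar L ℂ}
    (hψ : ψ.IsPrimitive) {b : L} (hb : b ≠ 0) :
    ∑ z : K, traceLift K ψ (algebraMap L K b * z ^ 2) = - Fintype.card L := by
  classical
  have h0 := five_eq_zero L
  have h2' : (2 : L) ≠ 0 := fun h => one_ne_zero (α := L) (by linear_combination h0 - 2 * h)
  obtain ⟨g, hg⟩ := FiniteField.exists_nonsquare (F := L) (by rw [ringChar.eq L 5]; norm_num)
  obtain ⟨θ, hθ⟩ := exists_sq_eq_algebraMap h2 g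
  have hsplit : ∑ z : K, traceLift K ψ (algebraMap L K b * z ^ 2) =
      (∑ u, ψ (2 * b * u ^ 2)) * ∑ v, ψ (2 * b * (g * v ^ 2)) := by
    rw [sum_eq_sum_add_mul_sqrt h2 hg hθ, Finset.sum_mul_sum]
    refine Finset.sum_congr rfl fun u _ => Finset.sum_congr rfl fun v _ => ?_
    rw [show algebraMap L K b * (algebraMap L K u + algebraMap L K v * θ) ^ 2 =
        algebraMap L K (b * (u ^ 2 + g * v ^ 2)) + algebraMap L K (2 * b * u * v) * θ by
      simp only [map_mul, map_add, map_pow, map_ofNat (algebraMap L K) 2]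
      linear_combination algebraMap L K b * algebraMap L K v ^ 2 * hθ,
      traceLift_apply, trace_add_mul_sqrt h2 hg hθ, ← AddChar.map_add_eq_mul]
    congr 1
    ring
  have hsum := sum_comp_sq_add_sum_comp_mul_sq hg fun x => ψ (2 * b * x)
  rw [show ∑ x, ψ (2 * b * x) = 0 by
    simp_rw [mul_comm (2 * b)]
    rw [AddChar.sum_mulShift _ hψ, if_neg (mul_ne_zero h2' hb), Nat.cast_zero]] at hsum
  have hG := gauss_sum_sq hψ (mul_ne_zero h2' hb)
  rw [hsplit]
  linear_combination (∑ u, ψ (2 * b * u ^ 2)) * hsum - hG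

/-- The sum over `K` in coordinates `u + v θ`, and the squared sum over `L` in coordinates `x = u +
v`, `y = u - v`, have the same phase except that `g * v ^ 2` replaces `v ^ 2`. Together they are
twice a sum over all `w`, linear in `w`, which survives only at `u = 0`. -/
theorem sum_traceLift_cubic (h2 : Module.finrank L K = 2) {ψ : AddChar L ℂ}
    (hψ : ψ.IsPrimitive) {c : L} (hc : c ≠ 0) (a : L) :
    ∑ z : K, traceLift K ψ (algebraMap L K c * z ^ 3 + algebraMap L K a * z) =
      2 * Fintype.card L - (∑ x, ψ (c * x ^ 3 + a * x)) ^ 2 := by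
  classical
  have h0 := five_eq_zero L
  obtain ⟨g, hg⟩ := FiniteField.exists_nonsquare (F := L) (by rw [ringChar.eq L 5]; norm_num)
  obtain ⟨θ, hθ⟩ := exists_sq_eq_algebraMap h2 g
  have hK : ∑ z : K, traceLift K ψ (algebraMap L K c * z ^ 3 + algebraMap L K a * z) =
      ∑ u, ∑ v, ψ (2 * c * u ^ 3 + 2 * a * u + (g * v ^ 2) * (c * u)) := by
    rw [sum_eq_sum_add_mul_sqrt h2 hg hθ]
    refine Finset.sum_congr rfl fun u _ => Finset.sum_congr rfl fun v _ => ?_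
    rw [show algebraMap L K c * (algebraMap L K u + algebraMap L K v * θ) ^ 3 +
        algebraMap L K a * (algebraMap L K u + algebraMap L K v * θ) =
        algebraMap L K (c * (u ^ 3 + 3 * u * g * v ^ 2) + a * u) +
          algebraMap L K (c * (3 * u ^ 2 * v + g * v ^ 3) + a * v) * θ by
      simp only [map_mul, map_add, map_pow, map_ofNat (algebraMap L K) 3]
      linear_combination algebraMap L K c * (3 * algebraMap L K u * algebraMap L K v ^ 2 +
        algebraMap L K v ^ 3 * θ) * hθ,
      traceLift_apply, trace_add_mul_sqrt h2 hg hθ]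
    congr 1
    linear_combination (c * u * g * v ^ 2) * h0
  have hL : (∑ x, ψ (c * x ^ 3 + a * x)) ^ 2 =
      ∑ u, ∑ v, ψ (2 * c * u ^ 3 + 2 * a * u + v ^ 2 * (c * u)) := by
    -- The 3 in the inverse is `1 / 2` modulo 5.
    let e : L × L ≃ L × L :=
      { toFun := fun p => (p.1 + p.2, p.1 - p.2)
        invFun := fun p => (3 * (p.1 + p.2), 3 * (p.1 - p.2))
        left_inv := fun p => by
          ext
          · simp only; linear_combination p.1 * h0
          · simp only; linear_combination p.2 * h0
        right_inv := fun p => by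
          ext
          · simp only; linear_combination p.1 * h0
          · simp only; linear_combination p.2 * h0 }
    rw [sq, Finset.sum_mul_sum,
      ← Fintype.sum_prod_type' (f := fun x y => ψ (c * x ^ 3 + a * x) * ψ (c * y ^ 3 + a * y)),
      ← Equiv.sum_comp e, ← Fintype.sum_prod_type'
        (f := fun u v => ψ (2 * c * u ^ 3 + 2 * a * u + v ^ 2 * (c * u)))]
    refine Finset.sum_congr rfl fun p _ => ?_
    rw [← AddChar.map_add_eq_mul]
    congr 1
    simp only [e, Equiv.coe_fn_mk]
    linear_combination (c * p.1 * p.2 ^ 2) * h0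
  have hsum (u : L) : ∑ v, ψ (2 * c * u ^ 3 + 2 * a * u + v ^ 2 * (c * u)) +
      ∑ v, ψ (2 * c * u ^ 3 + 2 * a * u + (g * v ^ 2) * (c * u)) =
      if u = 0 then 2 * (Fintype.card L : ℂ) else 0 := by
    rw [sum_comp_sq_add_sum_comp_mul_sq hg fun w => ψ (2 * c * u ^ 3 + 2 * a * u + w * (c * u))]
    simp_rw [AddChar.map_add_eq_mul, ← Finset.mul_sum]
    rw [AddChar.sum_mulShift _ hψ]
    by_cases hu : u = 0
    · simp [hu]
    · simp [hu, hc]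
  have := Finset.sum_congr rfl fun u (_ : u ∈ Finset.univ) => hsum u
  rw [Finset.sum_add_distrib, ← hK, ← hL, Finset.sum_ite_eq' Finset.univ (0 : L)] at this
  simp only [Finset.mem_univ, if_true] at this
  linear_combination this

theorem sum_traceLift_cubic_eq (h2 : Module.finrank L K = 2) {ψ : AddChar L ℂ}
    (hψ : ψ.IsPrimitive) (h5 : ∀ x, ψ (x ^ 5) = ψ x) {r n : ℕ} (hn : 30 ∣ n)
    (hL : Fintype.card L = (5 ^ r) ^ n) {c a : L} (hc0 : c ≠ 0) (hc : c ^ 5 ^ r = c)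
    (ha : a ^ 5 ^ r = a) :
    ∑ z : K, traceLift K ψ (algebraMap L K c * z ^ 3 + algebraMap L K a * z) =
      -2 * Fintype.card L := by
  have : CharP K 5 := charP_of_injective_algebraMap (algebraMap L K).injective 5
  have hcard := card_of_finrank_two h2
  have h1 := sum_traceLift_cubic h2 hψ hc0 a
  have hSL := cubic_sum_sq hψ h5 hn hL hc0 hc ha
  have hSK := cubic_sum_sq (traceLift_isPrimitive (L := K) hψ) (traceLift_pow_five h5)
    (r := r) (n := n * 2) (hn.mul_right 2) (by rw [hcard, hL, ← pow_mul])
    (c := algebraMap L K c) (a := algebraMap L K a) (by simpa using hc0) (by rw [← map_pow, hc])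
    (by rw [← map_pow, ha])
  rw [hcard] at hSK
  push_cast at hSK
  have hQ : (Fintype.card L : ℂ) ≠ 0 := Nat.cast_ne_zero.2 Fintype.card_ne_zero
  -- In the first case the sum over `K` would be `-7 Q`, with square `49 Q ^ 2`, which is neither `9
  -- Q ^ 2` nor `4 Q ^ 2`: the differences are `40 Q ^ 2` and `45 Q ^ 2`.
  rcases hSL with h | h
  · exfalso
    rw [h1, h] at hSK
    have hQ2 := pow_ne_zero 2 hQ
    rcases hSK with h' | h'
    · exact hQ2 (by linear_combination h' / 40)
    · exact hQ2 (by linear_combination h' / 45)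
  · rw [h1, h]
    ring

end QuadraticExtension

/-! ### Counting elements of `K` with prescribed power traces. -/

theorem sum_traceLift_linear {F K : Type*} [Field F] [Field K] [Fintype K] [Algebra F K]
    {ψ : AddChar F ℂ} (hψ : ψ.IsPrimitive) (a : F) [Decidable (a = 0)] :
    ∑ x : K, traceLift K ψ (algebraMap F K a * x) = if a = 0 then (Fintype.card K : ℂ) else 0 := by
  classical
  simp_rw [mul_comm (algebraMap F K a)]
  rw [AddChar.sum_mulShift _ (traceLift_isPrimitive hψ)]
  simp

theorem sum_addChar_mul {F : Type*} [Field F] [Fintype F] {ψ : AddChar F ℂ} (hψ : ψ.IsPrimitive) (x : F) [Decidable (x = 0)] :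
    ∑ a : F, ψ (a * x) = if x = 0 then (Fintype.card F : ℂ) else 0 := by
  classical
  rw [AddChar.sum_mulShift _ hψ]
  simp

theorem traceLift_add_algebraMap {F K : Type*} [Field F] [CharP F 5] [Field K] [Algebra F K]
    (h5 : 5 ∣ Module.finrank F K) (ψ : AddChar F ℂ) (x : K) (d : F) :
    traceLift K ψ (x + algebraMap F K d) = traceLift K ψ x := by
  obtain ⟨m, hm⟩ := h5
  rw [traceLift_apply, traceLift_apply, map_add, Algebra.trace_algebraMap, hm, mul_nsmul',
    nsmul_eq_mul, Nat.cast_ofNat, five_eq_zero, zero_mul, add_zero]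

/-- The number of elements with prescribed traces of the first three powers, in terms of
exponential sums. -/
theorem card_trace_pow_eq_sum {F K : Type*} [Field F] [Field K] [Fintype F] [DecidableEq F]
    [Fintype K] [Algebra F K] {ψ : AddChar F ℂ} (hψ : ψ.IsPrimitive) (s₁ s₂ s₃ : F) :
    (Fintype.card F : ℂ) ^ 3 * (Finset.univ.filter fun x : K => Algebra.trace F K x = s₁ ∧
      Algebra.trace F K (x ^ 2) = s₂ ∧ Algebra.trace F K (x ^ 3) = s₃).card =
    ∑ a, ∑ b, ∑ c, ψ (-(a * s₁ + b * s₂ + c * s₃)) * ∑ x : K, traceLift K ψ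
      (algebraMap F K a * x + algebraMap F K b * x ^ 2 + algebraMap F K c * x ^ 3) := by
  have key (x : K) : ∑ a, ∑ b, ∑ c, ψ (-(a * s₁ + b * s₂ + c * s₃)) * traceLift K ψ
      (algebraMap F K a * x + algebraMap F K b * x ^ 2 + algebraMap F K c * x ^ 3) =
      if Algebra.trace F K x = s₁ ∧ Algebra.trace F K (x ^ 2) = s₂ ∧ Algebra.trace F K (x ^ 3) = s₃
      then (Fintype.card F : ℂ) ^ 3 else 0 := by
    have (a b c : F) : ψ (-(a * s₁ + b * s₂ + c * s₃)) * traceLift K ψ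
        (algebraMap F K a * x + algebraMap F K b * x ^ 2 + algebraMap F K c * x ^ 3) =
        ψ (a * (Algebra.trace F K x - s₁)) * (ψ (b * (Algebra.trace F K (x ^ 2) - s₂)) *
          ψ (c * (Algebra.trace F K (x ^ 3) - s₃))) := by
      rw [traceLift_apply, ← AddChar.map_add_eq_mul, ← AddChar.map_add_eq_mul,
        ← AddChar.map_add_eq_mul]
      simp only [← Algebra.smul_def, map_add, map_smul, smul_eq_mul]
      congr 1
      ring
    simp_rw [this, ← Finset.mul_sum, ← Finset.sum_mul]
    rw [sum_addChar_mul hψ, sum_addChar_mul hψ, sum_addChar_mul hψ]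
    simp only [sub_eq_zero]
    by_cases h1 : Algebra.trace F K x = s₁ <;> by_cases h2 : Algebra.trace F K (x ^ 2) = s₂ <;>
      by_cases h3 : Algebra.trace F K (x ^ 3) = s₃ <;> simp only [h1, h2, h3, if_true, if_false,
        and_true, and_false, mul_zero, zero_mul]
    ring
  rw [Finset.card_filter]
  push_cast
  rw [Finset.mul_sum]
  simp_rw [mul_ite, mul_one, mul_zero, ← key, Finset.mul_sum]
  rw [Finset.sum_comm]
  refine Finset.sum_congr rfl fun a _ => ?_
  rw [Finset.sum_comm]
  refine Finset.sum_congr rfl fun b _ => ?_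
  rw [Finset.sum_comm]

section Tower

variable {F L K : Type*} [Field F] [Field L] [Field K] [Fintype F] [Fintype L] [Fintype K]
  [CharP F 5] [Algebra F L] [Algebra L K] [Algebra F K] [IsScalarTower F L K]

theorem sum_traceLift_quadratic_of_tower (h30 : Module.finrank F L = 30)
    (h2 : Module.finrank L K = 2) {ψ : AddChar F ℂ} (hψ : ψ.IsPrimitive) (a : F) {b : F}
    (hb : b ≠ 0) :
    ∑ x : K, traceLift K ψ (algebraMap F K a * x + algebraMap F K b * x ^ 2) =
      -(Fintype.card F : ℂ) ^ 30 := by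
  have h0 := five_eq_zero F
  have : CharP L 5 := charP_of_injective_algebraMap (algebraMap F L).injective 5
  have h60 : 5 ∣ Module.finrank F K := by
    rw [← Module.finrank_mul_finrank F L K, h30, h2]; norm_num
  have hcard : Fintype.card L = Fintype.card F ^ 30 := by
    rw [Module.card_eq_pow_finrank (K := F) (V := L), h30]
  have key := sum_traceLift_quadratic h2 (traceLift_isPrimitive (L := L) hψ)
    (b := algebraMap F L b) (by simpa using hb)
  rw [hcard, traceLift_traceLift, ← IsScalarTower.algebraMap_apply, Nat.cast_pow] at key
  -- Completing the square: with shift `s = 2 * a / b` the linear coefficient becomes `a + 2 * b * s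
  -- = 5 * a = 0`, and the leftover constant has trace 0.
  rw [← key, ← Equiv.sum_comp (Equiv.addRight (algebraMap F K (2 * a / b)))]
  refine Finset.sum_congr rfl fun x _ => ?_
  rw [← traceLift_add_algebraMap h60 ψ (algebraMap F K b * x ^ 2)
    (a * (2 * a / b) + b * (2 * a / b) ^ 2)]
  congr 1
  have hd : b * (2 * a / b) = 2 * a := by field_simp
  have hd' := congrArg (algebraMap F K) hd
  have h0' := congrArg (algebraMap F K) h0
  simp only [map_mul, map_add, map_pow, Equiv.coe_addRight, map_ofNat (algebraMap F K) 2,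
    map_ofNat (algebraMap F K) 5, map_zero] at hd' h0' ⊢
  linear_combination 2 * x * hd' + algebraMap F K a * x * h0'

theorem sum_traceLift_cubic_of_tower (h30 : Module.finrank F L = 30)
    (h2 : Module.finrank L K = 2) {r : ℕ} (hF : Fintype.card F = 5 ^ r) {ψ : AddChar F ℂ}
    (hψ : ψ.IsPrimitive) (h5 : ∀ x, ψ (x ^ 5) = ψ x) (a b : F) {c : F} (hc : c ≠ 0) :
    ∑ x : K, traceLift K ψ
      (algebraMap F K a * x + algebraMap F K b * x ^ 2 + algebraMap F K c * x ^ 3) =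
      -2 * (Fintype.card F : ℂ) ^ 30 := by
  have h0 := five_eq_zero F
  have : CharP L 5 := charP_of_injective_algebraMap (algebraMap F L).injective 5
  have h60 : 5 ∣ Module.finrank F K := by
    rw [← Module.finrank_mul_finrank F L K, h30, h2]; norm_num
  have hcard : Fintype.card L = Fintype.card F ^ 30 := by
    rw [Module.card_eq_pow_finrank (K := F) (V := L), h30]
  have hpow (x : F) : algebraMap F L x ^ 5 ^ r = algebraMap F L x := by
    rw [← hF, ← map_pow, FiniteField.pow_card]
  -- Shift removing the quadratic term: `b + 3 * c * s = 10 * b = 0`.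
  set s := 3 * b / c with hs
  have key := sum_traceLift_cubic_eq (K := K) h2 (traceLift_isPrimitive (L := L) hψ)
    (traceLift_pow_five h5) (n := 30) dvd_rfl (by rw [hcard, hF]) (c := algebraMap F L c)
    (a := algebraMap F L (a + 2 * b * s + 3 * c * s ^ 2)) (by simpa using hc) (hpow c) (hpow _)
  rw [hcard, traceLift_traceLift, ← IsScalarTower.algebraMap_apply,
    ← IsScalarTower.algebraMap_apply, Nat.cast_pow] at key
  rw [← key, ← Equiv.sum_comp (Equiv.addRight (algebraMap F K s))]
  refine Finset.sum_congr rfl fun x _ => ?_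
  rw [← traceLift_add_algebraMap h60 ψ (algebraMap F K c * x ^ 3 +
    algebraMap F K (a + 2 * b * s + 3 * c * s ^ 2) * x) (a * s + b * s ^ 2 + c * s ^ 3)]
  congr 1
  have hd : c * s = 3 * b := by rw [hs]; field_simp
  have hd' := congrArg (algebraMap F K) hd
  have h0' := congrArg (algebraMap F K) h0
  simp only [map_mul, map_add, map_pow, Equiv.coe_addRight, map_ofNat (algebraMap F K) 2,
    map_ofNat (algebraMap F K) 3, map_ofNat (algebraMap F K) 5, map_zero] at hd' h0' ⊢
  linear_combination 3 * x ^ 2 * hd' + 2 * algebraMap F K b * x ^ 2 * h0'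

theorem card_trace_pow [DecidableEq F] (h30 : Module.finrank F L = 30)
    (h2 : Module.finrank L K = 2) {r : ℕ} (hF : Fintype.card F = 5 ^ r) (s₁ s₂ s₃ : F) :
    ((Finset.univ.filter fun x : K => Algebra.trace F K x = s₁ ∧
      Algebra.trace F K (x ^ 2) = s₂ ∧ Algebra.trace F K (x ^ 3) = s₃).card : ℂ) =
      (Fintype.card F : ℂ) ^ 57 - (Fintype.card F : ℂ) ^ 28 *
        (2 * (Fintype.card F : ℂ) ^ 2 * (if s₁ = 0 ∧ s₂ = 0 ∧ s₃ = 0 then 1 else 0)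
          - (Fintype.card F : ℂ) * (if s₁ = 0 ∧ s₂ = 0 then 1 else 0)
          - (if s₁ = 0 then 1 else 0)) := by
  obtain ⟨ψ, hψ, h5⟩ := exists_primitive_addChar F
  set q : ℂ := (Fintype.card F : ℂ) with hq
  have hq0 : q ≠ 0 := Nat.cast_ne_zero.2 Fintype.card_ne_zero
  have hcard : (Fintype.card K : ℂ) = q ^ 60 := by
    rw [Module.card_eq_pow_finrank (K := F) (V := K), ← Module.finrank_mul_finrank F L K, h30, h2]
    push_cast; rfl
  -- The cases are encoded as cumulative corrections to `-2 q ^ 30`, so that summing against the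
  -- characters produces nested indicators directly.
  have hT (a b c : F) : ∑ x : K, traceLift K ψ
      (algebraMap F K a * x + algebraMap F K b * x ^ 2 + algebraMap F K c * x ^ 3) =
      -2 * q ^ 30 + (if c = 0 then q ^ 30 else 0) +
      (if c = 0 ∧ b = 0 then q ^ 30 else 0) + (if c = 0 ∧ b = 0 ∧ a = 0 then q ^ 60 else 0) := by
    by_cases hc : c = 0
    · by_cases hb : b = 0
      · subst hc hb
        simp only [map_zero, zero_mul, add_zero]
        rw [sum_traceLift_linear hψ, hcard]
        by_cases ha : a = 0 <;> simp [ha] <;> ring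
      · subst hc
        simp only [map_zero, zero_mul, add_zero]
        rw [sum_traceLift_quadratic_of_tower h30 h2 hψ a hb]
        simp [hb]
        ring
    · rw [sum_traceLift_cubic_of_tower h30 h2 hF hψ h5 a b hc]
      simp [hc]
      rfl
  have hψ' (a b c : F) : ψ (-(a * s₁ + b * s₂ + c * s₃)) =
      ψ (a * -s₁) * (ψ (b * -s₂) * ψ (c * -s₃)) := by
    rw [← AddChar.map_add_eq_mul, ← AddChar.map_add_eq_mul]
    congr 1
    ring
  have main := card_trace_pow_eq_sum (K := K) hψ s₁ s₂ s₃
  have hsum : ∑ a, ∑ b, ∑ c, ψ (-(a * s₁ + b * s₂ + c * s₃)) * ∑ x : K, traceLift K ψ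
      (algebraMap F K a * x + algebraMap F K b * x ^ 2 + algebraMap F K c * x ^ 3) =
      -2 * q ^ 30 * ((∑ a, ψ (a * -s₁)) * ((∑ b, ψ (b * -s₂)) * ∑ c, ψ (c * -s₃))) +
      q ^ 30 * ((∑ a, ψ (a * -s₁)) * ∑ b, ψ (b * -s₂)) + q ^ 30 * (∑ a, ψ (a * -s₁)) + q ^ 60 := by
    have hc (a b : F) : ∑ c, ψ (a * -s₁) * (ψ (b * -s₂) * ψ (c * -s₃)) *
        (-2 * q ^ 30 + (if c = 0 then q ^ 30 else 0) +
        (if c = 0 ∧ b = 0 then q ^ 30 else 0) + (if c = 0 ∧ b = 0 ∧ a = 0 then q ^ 60 else 0)) =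
        ψ (a * -s₁) * (-2 * q ^ 30 * ((∑ c, ψ (c * -s₃)) * ψ (b * -s₂)) + q ^ 30 * ψ (b * -s₂)
          + (if b = 0 then q ^ 30 * ψ (b * -s₂) else 0)
          + (if b = 0 then (if a = 0 then q ^ 60 * ψ (b * -s₂) else 0) else 0)) := by
      simp only [ite_and, mul_add, Finset.sum_add_distrib, mul_ite, mul_zero,
        Finset.sum_ite_eq', Finset.mem_univ, if_true, ← Finset.sum_mul, ← Finset.mul_sum, zero_mul,
        AddChar.map_zero_eq_one]
      split_ifs <;> ring
    have hb (a : F) : ∑ b, (-2 * q ^ 30 * ((∑ c, ψ (c * -s₃)) * ψ (b * -s₂)) + q ^ 30 * ψ (b * -s₂)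
          + (if b = 0 then q ^ 30 * ψ (b * -s₂) else 0)
          + (if b = 0 then (if a = 0 then q ^ 60 * ψ (b * -s₂) else 0) else 0)) =
        -2 * q ^ 30 * ((∑ c, ψ (c * -s₃)) * ∑ b, ψ (b * -s₂)) + q ^ 30 * ∑ b, ψ (b * -s₂) + q ^ 30
          + (if a = 0 then q ^ 60 else 0) := by
      simp only [Finset.sum_add_distrib, Finset.sum_ite_eq', Finset.mem_univ, if_true,
        ← Finset.mul_sum, zero_mul, AddChar.map_zero_eq_one, mul_one]
    simp_rw [hT, hψ', hc, ← Finset.mul_sum, hb]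
    simp only [mul_add, Finset.sum_add_distrib, mul_ite, mul_zero, Finset.sum_ite_eq',
      Finset.mem_univ, if_true, ← Finset.sum_mul, zero_mul, AddChar.map_zero_eq_one]
    ring
  rw [hsum, sum_addChar_mul hψ, sum_addChar_mul hψ, sum_addChar_mul hψ] at main
  simp only [neg_eq_zero] at main
  apply mul_left_cancel₀ (pow_ne_zero 3 hq0)
  rw [main]
  by_cases h1 : s₁ = 0 <;> by_cases h2 : s₂ = 0 <;> by_cases h3 : s₃ = 0 <;>
    simp only [h1, h2, h3, if_true, if_false, and_true, and_false] <;> ring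

end Tower

/-! ### Newton's identities. -/

theorem reverse_prod_X_sub_C {K : Type*} [Field K] (x : ℕ → K) (n : ℕ) :
    (∏ i ∈ Finset.range n, (X - C (x i))).reverse = ∏ i ∈ Finset.range n, (1 - C (x i) * X) := by
  induction n with
  | zero => simpa using reverse_C (1 : K)
  | succ n ih =>
    rw [Finset.prod_range_succ, Finset.prod_range_succ, reverse_mul_of_domain, ih]
    congr 1
    ext k
    rw [coeff_reverse, natDegree_X_sub_C]
    rcases k with _ | _ | k
    · simp [revAt_le]
    · simp [revAt_le, coeff_one]
    · rw [revAt_eq_self_of_lt (by omega)]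
      simp [coeff_X, coeff_one]

/-- Newton's identities for the first three power sums. -/
theorem power_sums_eq_of_prod {K : Type*} [Field K] (x : ℕ → K) (n : ℕ) {h : K[X]}
    (hh : h = ∏ i ∈ Finset.range n, (1 - C (x i) * X)) :
    h.coeff 0 = 1 ∧ ∑ i ∈ Finset.range n, x i = -h.coeff 1 ∧
    ∑ i ∈ Finset.range n, x i ^ 2 = h.coeff 1 ^ 2 - 2 * h.coeff 2 ∧
    ∑ i ∈ Finset.range n, x i ^ 3 =
      -h.coeff 1 ^ 3 + 3 * h.coeff 1 * h.coeff 2 - 3 * h.coeff 3 := by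
  induction n generalizing h with
  | zero => simp [hh, coeff_one]
  | succ n ih =>
    obtain ⟨h0, h1, h2, h3⟩ := ih rfl
    rw [Finset.prod_range_succ] at hh
    generalize ∏ i ∈ Finset.range n, (1 - C (x i) * X) = p at *
    have hp : h = p - C (x n) * (p * X) := by rw [hh]; ring
    have c0 : h.coeff 0 = p.coeff 0 := by simp [hp]
    have cs (k : ℕ) : h.coeff (k + 1) = p.coeff (k + 1) - x n * p.coeff k := by
      rw [hp, coeff_sub, coeff_C_mul, coeff_mul_X]
    have c1 := cs 0
    have c2 := cs 1
    have c3 := cs 2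
    norm_num at c1 c2 c3
    rw [Finset.sum_range_succ, Finset.sum_range_succ, Finset.sum_range_succ, c0, h1, h2, h3, c1, c2,
      c3, h0]
    refine ⟨rfl, by ring, by ring, by ring⟩

/-! ### Prime powers as characteristic polynomials of field elements. -/

section Conjugates

variable {F K : Type*} [Field F] [Field K] [Algebra F K]

/-- The characteristic polynomial of `x`, as a power of its minimal polynomial. -/
def fieldCharpoly (F : Type*) {K : Type*} [Field F] [Field K] [Algebra F K] (x : K) : F[X] :=
  minpoly F x ^ (Module.finrank F K / (minpoly F x).natDegree)

theorem pow_card_pow_injective [Fintype F] (n : ℕ) :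
    Function.Injective fun x : K => x ^ Fintype.card F ^ n := by
  have : (fun x : K => x ^ Fintype.card F ^ n) = (FiniteField.frobeniusAlgHom F K)^[n] := by
    rw [FiniteField.coe_frobeniusAlgHom, pow_iterate]
  rw [this]
  exact (FiniteField.frobeniusAlgHom F K).toRingHom.injective.iterate n

theorem aeval_pow_card_pow [Fintype F] {p : F[X]} {x : K} (h : aeval x p = 0) (n : ℕ) :
    aeval (x ^ Fintype.card F ^ n) p = 0 := by
  have : x ^ Fintype.card F ^ n = (FiniteField.frobeniusAlgHom F K ^ n) x := by
    rw [AlgHom.coe_pow, FiniteField.coe_frobeniusAlgHom, pow_iterate]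
  rw [this, aeval_algHom_apply, h, map_zero]

variable [Fintype K]

theorem natDegree_minpoly_dvd (x : K) : (minpoly F x).natDegree ∣ Module.finrank F K :=
  minpoly.degree_dvd (.of_finite F x)

theorem monic_fieldCharpoly (x : K) : (fieldCharpoly F x).Monic :=
  (minpoly.monic (.of_finite F x)).pow _

theorem natDegree_fieldCharpoly (x : K) : (fieldCharpoly F x).natDegree = Module.finrank F K := by
  rw [fieldCharpoly, natDegree_pow, Nat.div_mul_cancel (natDegree_minpoly_dvd x)]

variable [Fintype F]

theorem pow_card_pow_eq_self_iff (x : K) (n : ℕ) :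
    x ^ Fintype.card F ^ n = x ↔ (minpoly F x).natDegree ∣ n := by
  rw [(minpoly.irreducible (.of_finite F x)).natDegree_dvd_iff_dvd_X_pow_card_pow_sub_X,
    minpoly.dvd_iff, Nat.card_eq_fintype_card]
  simp [sub_eq_zero]

theorem map_minpoly_eq_prod (x : K) : (minpoly F x).map (algebraMap F K) =
    ∏ i ∈ Finset.range (minpoly F x).natDegree, (X - C (x ^ Fintype.card F ^ i)) := by
  have hm : (minpoly F x).Monic := minpoly.monic (.of_finite F x)
  rw [← Fin.prod_univ_eq_prod_range (fun i => X - C (x ^ Fintype.card F ^ i))]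
  refine eq_of_monic_of_dvd_of_natDegree_le (monic_prod_of_monic _ _ fun i _ => monic_X_sub_C _)
    (hm.map _) ?_ ?_
  · refine Fintype.prod_dvd_of_coprime (pairwise_coprime_X_sub_C
      (s := fun i : Fin (minpoly F x).natDegree => x ^ Fintype.card F ^ (i : ℕ)) ?_) fun i => ?_
    · have key (i j : ℕ) (hij : i < j) (hj : j < (minpoly F x).natDegree) :
          x ^ Fintype.card F ^ i ≠ x ^ Fintype.card F ^ j := by
        intro h
        rw [show j = (j - i) + i by omega, pow_add, pow_mul] at h
        have := (pow_card_pow_eq_self_iff x _).1 (pow_card_pow_injective (F := F) i h).symm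
        exact absurd (Nat.le_of_dvd (by omega) this) (by omega)
      intro i j h
      rcases lt_trichotomy (i : ℕ) j with hij | hij | hij
      · exact absurd h (key i j hij j.2)
      · exact Fin.ext hij
      · exact absurd h.symm (key j i hij i.2)
    · rw [dvd_iff_isRoot, IsRoot.def, eval_map_algebraMap]
      exact aeval_pow_card_pow (minpoly.aeval F x) i
  · rw [natDegree_map, natDegree_prod_of_monic _ _ fun i _ => monic_X_sub_C _]
    simp only [natDegree_X_sub_C, Finset.sum_const, Finset.card_univ, Fintype.card_fin, smul_eq_mul,
      mul_one, le_refl]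

/-- The list of `[K : F]` Frobenius conjugates runs through the orbit of `x` a whole number of
times, once for each factor `minpoly F x`. -/
theorem map_fieldCharpoly_eq_prod (x : K) : (fieldCharpoly F x).map (algebraMap F K) =
    ∏ i ∈ Finset.range (Module.finrank F K), (X - C (x ^ Fintype.card F ^ i)) := by
  have key (k : ℕ) : ∏ i ∈ Finset.range ((minpoly F x).natDegree * k),
      (X - C (x ^ Fintype.card F ^ i)) =
      (∏ i ∈ Finset.range (minpoly F x).natDegree, (X - C (x ^ Fintype.card F ^ i))) ^ k := by
    induction k with
    | zero => simp
    | succ k ih =>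
      rw [Nat.mul_succ, Finset.prod_range_add, ih, pow_succ]
      congr 1
      refine Finset.prod_congr rfl fun i _ => ?_
      rw [pow_add, pow_mul, (pow_card_pow_eq_self_iff x _).2 (dvd_mul_right _ _)]
  rw [fieldCharpoly, Polynomial.map_pow, map_minpoly_eq_prod, ← key,
    Nat.mul_div_cancel' (natDegree_minpoly_dvd x)]

theorem trace_pow_eq_sum (x : K) (j : ℕ) : algebraMap F K (Algebra.trace F K (x ^ j)) =
    ∑ i ∈ Finset.range (Module.finrank F K), (x ^ Fintype.card F ^ i) ^ j := by
  rw [FiniteField.algebraMap_trace_eq_sum_pow, Nat.card_eq_fintype_card]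
  exact Finset.sum_congr rfl fun i _ => pow_right_comm x j _

theorem trace_pow_eq_coeff_fieldCharpoly (x : K) (h3 : 3 ≤ Module.finrank F K) :
    Algebra.trace F K x = -nextToLeadingCoeff (fieldCharpoly F x) 1 ∧
    Algebra.trace F K (x ^ 2) = nextToLeadingCoeff (fieldCharpoly F x) 1 ^ 2 -
      2 * nextToLeadingCoeff (fieldCharpoly F x) 2 ∧
    Algebra.trace F K (x ^ 3) = -nextToLeadingCoeff (fieldCharpoly F x) 1 ^ 3 +
      3 * nextToLeadingCoeff (fieldCharpoly F x) 1 * nextToLeadingCoeff (fieldCharpoly F x) 2 -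
      3 * nextToLeadingCoeff (fieldCharpoly F x) 3 := by
  have hcoeff (j : ℕ) (hj : j ≤ 3) : (∏ i ∈ Finset.range (Module.finrank F K),
      (1 - C (x ^ Fintype.card F ^ i) * X)).coeff j =
      algebraMap F K (nextToLeadingCoeff (fieldCharpoly F x) j) := by
    rw [← reverse_prod_X_sub_C, ← map_fieldCharpoly_eq_prod, coeff_reverse, natDegree_map,
      natDegree_fieldCharpoly, revAt_le (hj.trans h3), coeff_map, nextToLeadingCoeff,
      natDegree_fieldCharpoly, if_pos (hj.trans h3)]
  obtain ⟨-, e1, e2, e3⟩ := power_sums_eq_of_prod (fun i => x ^ Fintype.card F ^ i)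
    (Module.finrank F K) rfl
  rw [hcoeff 1 (by norm_num)] at e1 e2 e3
  rw [hcoeff 2 (by norm_num)] at e2 e3
  rw [hcoeff 3 (by norm_num)] at e3
  have e0 := trace_pow_eq_sum (F := F) x 1
  simp only [pow_one] at e0
  refine ⟨(algebraMap F K).injective ?_, (algebraMap F K).injective ?_,
    (algebraMap F K).injective ?_⟩
  · rw [e0, e1, map_neg]
  · rw [trace_pow_eq_sum, e2]
    simp only [map_sub, map_mul, map_pow, map_ofNat (algebraMap F K) 2]
  · rw [trace_pow_eq_sum, e3]
    simp only [map_sub, map_mul, map_pow, map_neg, map_add, map_ofNat (algebraMap F K) 3]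

open Classical in
theorem card_minpoly_eq {P : F[X]} (hP : P.Monic) (hirr : Irreducible P)
    (hd : P.natDegree ∣ Module.finrank F K) :
    (Finset.univ.filter fun x : K => minpoly F x = P).card = P.natDegree := by
  have hsplit : Splits (P.map (algebraMap F K)) := by
    rw [hirr.natDegree_dvd_iff_dvd_X_pow_card_pow_sub_X] at hd
    have h := map_dvd (mapRingHom (algebraMap F K)) hd
    have hs := splits_X_pow_nat_card_sub_X (K := K)
    have hc : Nat.card K = Nat.card F ^ Module.finrank F K := by
      rw [Nat.card_eq_fintype_card, Nat.card_eq_fintype_card,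
        Module.card_eq_pow_finrank (K := F) (V := K)]
    refine Splits.of_dvd hs (FiniteField.X_pow_card_sub_X_ne_zero K Finite.one_lt_card) ?_
    rw [hc]
    simpa using h
  rw [← card_rootSet_eq_natDegree (PerfectField.separable_of_irreducible hirr) hsplit, ← Set.toFinset_card]
  congr 1
  ext x
  rw [Finset.mem_filter, Set.mem_toFinset, mem_rootSet]
  constructor
  · rintro ⟨-, rfl⟩
    exact ⟨hirr.ne_zero, minpoly.aeval F x⟩
  · rintro ⟨-, h⟩
    exact ⟨Finset.mem_univ _, (minpoly.eq_of_irreducible_of_monic hirr h hP).symm⟩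

-- If `f = P ^ k`, then `deg P` divides `[K : F]`, so `P` splits in `K` with `deg P` distinct roots,
-- and these are exactly the elements with characteristic polynomial `f`. Any other `f` has an empty
-- fibre.
open Classical in
theorem vonMangoldt_eq_card {f : F[X]} (hf : f.natDegree = Module.finrank F K) :
    vonMangoldt f = (Finset.univ.filter fun x : K => fieldCharpoly F x = f).card := by
  by_cases h : ∃ P : F[X], (P.Monic ∧ Irreducible P) ∧ ∃ k : ℕ, 1 ≤ k ∧ f = P ^ k
  · obtain ⟨P, ⟨hP, hirr⟩, k, hk, rfl⟩ := h
    rw [natDegree_pow] at hf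
    rw [vonMangoldt_pow hP hirr hk, ← card_minpoly_eq (K := K) hP hirr ⟨k, by rw [← hf, mul_comm]⟩]
    congr 2
    ext x
    simp only [Finset.mem_filter, Finset.mem_univ, true_and]
    constructor
    · intro hx
      rw [fieldCharpoly, hx, ← hf, Nat.mul_div_cancel _ hirr.natDegree_pos]
    · intro hx
      have hd : P ∣ fieldCharpoly F x := hx ▸ dvd_pow_self P (by omega)
      have hx' := minpoly.irreducible (IsIntegral.of_finite F x)
      exact (eq_of_monic_of_associated hP (minpoly.monic (.of_finite F x))
        (hirr.associated_of_dvd hx' (hirr.prime.dvd_of_dvd_pow hd))).symm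
  · rw [vonMangoldt_eq_zero h, eq_comm, Nat.cast_eq_zero, Finset.card_eq_zero,
      Finset.filter_eq_empty_iff]
    intro x _ hx
    refine h ⟨minpoly F x, ⟨minpoly.monic (.of_finite F x), minpoly.irreducible (.of_finite F x)⟩,
      _, ?_, hx.symm⟩
    exact Nat.div_pos (Nat.le_of_dvd Module.finrank_pos (natDegree_minpoly_dvd x))
      (minpoly.natDegree_pos (.of_finite F x))

open Classical in
theorem psi_eq_card {ℓ : ℕ} (t : Fin ℓ → F) : psi (Module.finrank F K) t =
    (Finset.univ.filter fun x : K =>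
      ∀ i : Fin ℓ, nextToLeadingCoeff (fieldCharpoly F x) (i + 1) = t i).card := by
  rw [psi, Finset.card_eq_sum_card_fiberwise (f := fun x : K => fieldCharpoly F x)
    (t := (finite_monicOfDegree F (Module.finrank F K)).toFinset.filter
      fun f => ∀ i : Fin ℓ, nextToLeadingCoeff f (i + 1) = t i)]
  · push_cast
    refine Finset.sum_congr rfl fun f hf => ?_
    rw [Finset.mem_filter, Set.Finite.mem_toFinset] at hf
    rw [vonMangoldt_eq_card (K := K) hf.1.2, Finset.filter_filter]
    congr 2
    ext x
    simp only [Finset.mem_filter, Finset.mem_univ, true_and]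
    constructor
    · rintro rfl
      exact ⟨hf.2, rfl⟩
    · exact fun h => h.2
  · intro x hx
    simp only [Finset.coe_filter, Set.mem_ofPred_eq, Finset.mem_univ, true_and,
      Set.Finite.mem_toFinset] at hx ⊢
    exact ⟨⟨monic_fieldCharpoly x, natDegree_fieldCharpoly x⟩, hx⟩

end Conjugates

/-! ### From coefficients to traces, and the final evaluation. -/

theorem psi_three_eq_card_trace {F K : Type*} [Field F] [Fintype F] [DecidableEq F] [CharP F 5] [Field K]
    [Fintype K] [Algebra F K] (h3 : 3 ≤ Module.finrank F K) (t₁ t₂ t₃ : F) :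
    psi (Module.finrank F K) ![t₁, t₂, t₃] = (Finset.univ.filter fun x : K =>
      Algebra.trace F K x = -t₁ ∧ Algebra.trace F K (x ^ 2) = t₁ ^ 2 - 2 * t₂ ∧
      Algebra.trace F K (x ^ 3) = -t₁ ^ 3 + 3 * t₁ * t₂ - 3 * t₃).card := by
  rw [psi_eq_card (K := K)]
  congr 2
  ext x
  have h0 := five_eq_zero F
  obtain ⟨e1, e2, e3⟩ := trace_pow_eq_coeff_fieldCharpoly (F := F) x h3
  simp only [Finset.mem_filter, Finset.mem_univ, true_and, e1, e2, e3, Fin.forall_fin_succ,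
    IsEmpty.forall_iff, and_true]
  simp only [Matrix.cons_val_zero, Matrix.cons_val_succ, Fin.val_zero, Fin.val_succ, zero_add,
    Nat.reduceAdd]
  generalize nextToLeadingCoeff (fieldCharpoly F x) 1 = u₁
  generalize nextToLeadingCoeff (fieldCharpoly F x) 2 = u₂
  generalize nextToLeadingCoeff (fieldCharpoly F x) 3 = u₃
  constructor
  · rintro ⟨rfl, rfl, rfl⟩
    exact ⟨rfl, rfl, rfl⟩
  · rintro ⟨h1, h2, h3⟩
    obtain rfl := neg_injective h1
    have h2' : u₂ = t₂ := by linear_combination 2 * h2 + (u₂ - t₂) * h0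
    subst h2'
    exact ⟨rfl, rfl, by linear_combination (-2) * h3 - (u₃ - t₃) * h0⟩

end PrescribedCoeff

end

theorem mainTheorem8 {F : Type*} [Field F] [Fintype F] [DecidableEq F] (q r : ℕ)
    (hq : q = 5 ^ r) (hF : Fintype.card F = q) (t₁ t₂ t₃ : F) :
    PrescribedCoeff.psi 60 ![t₁, t₂, t₃] =
      (q : ℂ) ^ 57 - (q : ℂ) ^ 28 *
        (2 * (q : ℂ) ^ 2 * (if t₁ = 0 ∧ t₂ = 0 ∧ t₃ = 0 then 1 else 0)
          - (q : ℂ) * (if t₁ = 0 ∧ t₂ = 0 then 1 else 0)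
          - (if t₁ = 0 then 1 else 0)) := by
  have hp : Fact (Nat.Prime 5) := ⟨by norm_num⟩
  have hcard : Fintype.card F = 5 ^ r := hF.trans hq
  have : CharP F 5 := charP_of_card_eq_prime_pow hcard
  -- The degree 60 is split as 30 times 2: 30 makes Frobenius act on the radical by a sign, and the
  -- quadratic step fixes the value of the cubic sum.
  let L := FiniteField.Extension F 5 30
  have : CharP L 5 := charP_of_injective_algebraMap (algebraMap F L).injective 5
  let K := FiniteField.Extension L 5 2
  have : Fintype L := Fintype.ofFinite L
  have : Fintype K := Fintype.ofFinite K
  let _ : Algebra F K := ((algebraMap L K).comp (algebraMap F L)).toAlgebra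
  have : IsScalarTower F L K := .of_algebraMap_eq fun _ => rfl
  have h30 : Module.finrank F L = 30 := FiniteField.finrank_extension F 5 30
  have h2 : Module.finrank L K = 2 := FiniteField.finrank_extension L 5 2
  have h60 : Module.finrank F K = 60 := by rw [← Module.finrank_mul_finrank F L K, h30, h2]
  have h0 := PrescribedCoeff.five_eq_zero F
  rw [← h60, PrescribedCoeff.psi_three_eq_card_trace (K := K) (by rw [h60]; norm_num),
    PrescribedCoeff.card_trace_pow h30 h2 hcard, hF]
  have i1 : -t₁ = 0 ↔ t₁ = 0 := neg_eq_zero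
  -- The indicator conditions on power sums and on coefficients agree because 2 and 3 are invertible
  -- modulo 5.
  have i2 : (-t₁ = 0 ∧ t₁ ^ 2 - 2 * t₂ = 0) ↔ (t₁ = 0 ∧ t₂ = 0) := by
    rw [i1]
    refine and_congr_right ?_
    rintro rfl
    exact ⟨fun h => by linear_combination 2 * h + t₂ * h0, fun h => by rw [h]; ring⟩
  have i3 : (-t₁ = 0 ∧ t₁ ^ 2 - 2 * t₂ = 0 ∧ -t₁ ^ 3 + 3 * t₁ * t₂ - 3 * t₃ = 0) ↔
      (t₁ = 0 ∧ t₂ = 0 ∧ t₃ = 0) := by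
    rw [← and_assoc, i2, and_assoc]
    refine and_congr_right ?_
    rintro rfl
    refine and_congr_right ?_
    rintro rfl
    exact ⟨fun h => by linear_combination (-2) * h - t₃ * h0, fun h => by rw [h]; ring⟩
  rw [if_congr i3 rfl rfl, if_congr i2 rfl rfl, if_congr i1 rfl rfl]
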